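/- Let $d>1$ and $m\ge 1$ be integers. Let $|\boldsymbol\psi\rangle$ be a Haar random state in $\mathbb{C}^d\otimes\mathbb{C}^m$, i.e. a random unit vector whose distribution is invariant under every unitary operator on $\mathbb{C}^d\otimes\mathbb{C}^m$, and let $\boldsymbol\rho=\operatorname{tr}_{\mathbb{C}^m}|\boldsymbol\psi\rangle\langle\boldsymbol\psi|$ be its reduction to the first register, a random $d\times d$ density matrix. Let $|\Psi_d\rangle=\sum_{i=1}^d|i\rangle\otimes|i\rangle$, $\Psi_d=|\Psi_d\rangle\langle\Psi_d|$ and $\Phi_d=\Psi_d/d$; let $\mathcal I_d$ be the identity map and $I_d$ the identity matrix on $\mathbb{C}^{d\times d}$ and $\mathbb{C}^d$ respectively; and let $\|A\|_1$ denote the trace norm of a matrix $A$ (the sum of its singular values). For a superoperator, i.e. a linear map $\mathcal L:\mathbb{C}^{d\times d}\to\mathbb{C}^{n\times n}$ with $n\in\mathbb{N}$ arbitrary, and a $d\times d$ density matrix $\rho$, put $$\|\mathcal L\|_{\mathrm{ACID}}=\bigl\|(\mathcal L\otimes\mathcal I_d)(\Phi_d)\bigr\|_1,\qquad \|\mathcal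 L\|_{\rho}=\bigl\|(\mathcal L\otimes\mathcal I_d)\bigl((\sqrt{\rho}\otimes I_d)\,\Psi_d\,(\sqrt{\rho}\otimes I_d)\bigr)\bigr\|_1 .$$ Then for every superoperator $\mathcal L:\mathbb{C}^{d\times d}\to\mathbb{C}^{n\times n}$, the random variable $\|\mathcal L\|_{\boldsymbol\rho}$ is integrable and $$\frac{m}{2d+m}\,\|\mathcal L\|_{\mathrm{ACID}}\;\le\;\mathbb{E}\,\|\mathcal L\|_{\boldsymbol\rho}\;\le\;\|\mathcal L\|_{\mathrm{ACID}} .$$ -/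

import Mathlib

open MeasureTheory ProbabilityTheory
open scoped Matrix MatrixOrder

noncomputable section

namespace AcidNorm

/-- The trace norm (Schatten 1-norm) of a complex square matrix: the sum of its singular values,
i.e. of the singular values of the operator it defines between Euclidean spaces. -/
def traceNorm {ι : Type*} [Fintype ι] [DecidableEq ι] (A : Matrix ι ι ℂ) : ℝ :=
  ∑ i ∈ Finset.range (Fintype.card ι), (Matrix.toEuclideanLin A).singularValues i

/-- A superoperator: a linear map from `d × d` matrices to `n × n` matrices over `ℂ`. -/
abbrev Superoperator (d n : ℕ) : Type :=
  Matrix (Fin d) (Fin d) ℂ →ₗ[ℂ] Matrix (Fin n) (Fin n) ℂ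

/-- The superoperator `L ⊗ I_k`, where `I_k` is the identity superoperator on `k × k` matrices,
acting on `M_d(ℂ) ⊗ M_k(ℂ)`, which is identified with the matrices indexed by `Fin d × Fin k`
(first register, second register): `L` is applied to each of the blocks `(X_{(p,i),(q,j)})_{p,q}`
with `i, j` fixed. -/
def tensorId {d n : ℕ} (L : Superoperator d n) (k : ℕ) :
    Matrix (Fin d × Fin k) (Fin d × Fin k) ℂ →ₗ[ℂ] Matrix (Fin n × Fin k) (Fin n × Fin k) ℂ where
  toFun X := Matrix.of fun a b =>
    L (Matrix.of fun p q => X (p, a.2) (q, b.2)) a.1 b.1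
  map_add' X Y := by
    ext a b
    exact congrFun (congrFun (L.map_add (Matrix.of fun p q => X (p, a.2) (q, b.2))
      (Matrix.of fun p q => Y (p, a.2) (q, b.2))) a.1) b.1
  map_smul' c X := by
    ext a b
    exact congrFun (congrFun (L.map_smul c (Matrix.of fun p q => X (p, a.2) (q, b.2))) a.1) b.1

/-- `L ⊗ I_k` is the linear map with `(L ⊗ I_k) (A ⊗ B) = L A ⊗ B`. -/
theorem tensorId_kronecker {d n k : ℕ} (L : Superoperator d n)
    (A : Matrix (Fin d) (Fin d) ℂ) (B : Matrix (Fin k) (Fin k) ℂ) :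
    tensorId L k (Matrix.kronecker A B) = Matrix.kronecker (L A) B := by
  ext a b
  have h : (Matrix.of fun p q => Matrix.kronecker A B (p, a.2) (q, b.2))
      = B a.2 b.2 • A := by
    ext p q
    simp [Matrix.kronecker, Matrix.kroneckerMap_apply, mul_comm]
  change L (Matrix.of fun p q => Matrix.kronecker A B (p, a.2) (q, b.2)) a.1 b.1 = _
  rw [h, L.map_smul]
  simp [Matrix.kronecker, Matrix.kroneckerMap_apply, mul_comm]

/-- The vector `|Ψ_d⟩ = ∑ᵢ |ii⟩` in `ℂ^d ⊗ ℂ^d`. -/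
def ketPsi (d : ℕ) : Fin d × Fin d → ℂ := fun p => if p.1 = p.2 then 1 else 0

/-- The unnormalized maximally entangled state `Ψ_d = |Ψ_d⟩⟨Ψ_d|`. -/
def Psi (d : ℕ) : Matrix (Fin d × Fin d) (Fin d × Fin d) ℂ :=
  Matrix.vecMulVec (ketPsi d) (star (ketPsi d))

/-- The maximally entangled state `Φ_d = Ψ_d / d`. -/
def Phi (d : ℕ) : Matrix (Fin d × Fin d) (Fin d × Fin d) ℂ := ((d : ℂ)⁻¹) • Psi d

/-- The Choi operator `(L ⊗ I_d) Φ_d`. -/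
def choi {d n : ℕ} (L : Superoperator d n) : Matrix (Fin n × Fin d) (Fin n × Fin d) ℂ :=
  tensorId L d (Phi d)

/-- The ACID norm of a superoperator: the trace norm of its Choi operator. -/
def acidNorm {d n : ℕ} (L : Superoperator d n) : ℝ := traceNorm (choi L)

/-- The `ρ` norm `‖(L ⊗ I_d) ((√ρ ⊗ I_d) Ψ_d (√ρ ⊗ I_d))‖₁` of a superoperator, where `√ρ` is the
positive semidefinite square root of the density matrix `ρ`. -/
def rhoNorm {d n : ℕ} (ρ : Matrix (Fin d) (Fin d) ℂ) (L : Superoperator d n) : ℝ :=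
  traceNorm (tensorId L d
    (Matrix.kronecker (CFC.sqrt ρ) (1 : Matrix (Fin d) (Fin d) ℂ) * Psi d *
      Matrix.kronecker (CFC.sqrt ρ) (1 : Matrix (Fin d) (Fin d) ℂ)))

/-- The reduction to the first register of the vector state `ψ` in `ℂ^d ⊗ ℂ^m`, i.e. the partial
trace of `|ψ⟩⟨ψ|` over the second register: its `(i, j)` entry is
`∑ₛ ⟨is|ψ⟩⟨ψ|js⟩`. -/
def reduction {d m : ℕ} (ψ : EuclideanSpace ℂ (Fin d × Fin m)) : Matrix (Fin d) (Fin d) ℂ :=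
  Matrix.of fun i j =>
    ∑ s, Matrix.vecMulVec (fun p => ψ p) (star fun p => ψ p) (i, s) (j, s)

/-- A random vector is a Haar random state if it is a unit vector and its law is invariant under
all unitary operators (these two conditions determine the law: it is the uniform probability
measure on the unit sphere). -/
structure IsHaarRandomState {ι : Type*} [Fintype ι] {Ω : Type*} [MeasurableSpace Ω]
    (P : Measure Ω) (ψ : Ω → EuclideanSpace ℂ ι) : Prop where
  aemeasurable : AEMeasurable ψ P
  norm_eq_one : ∀ᵐ ω ∂P, ‖ψ ω‖ = 1
  unitary_invariant : ∀ U : EuclideanSpace ℂ ι ≃ₗᵢ[ℂ] EuclideanSpace ℂ ι,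
    IdentDistrib (fun ω => U (ψ ω)) ψ P P

end AcidNorm

end

/-! Write J = (L ⊗ I)(Ψ_d) and s = √ρ. Since (s ⊗ 1)|Ψ_d⟩ = (1 ⊗ sᵀ)|Ψ_d⟩, the ρ norm is the trace
norm of the compression Y = (1 ⊗ sᵀ) J (1 ⊗ sᵀ), while the ACID norm is ‖J‖₁ / d. Only the second
moment of s is needed.

Local unitaries preserve the Haar law, so E[s ⊗ s] commutes with all u ⊗ u and is a combination of
the identity and the swap. As tr ρ = 1, a single parameter q remains, determined by E(tr √ρ)²
(`integral_sqrt_mul_sqrt`). Cauchy–Schwarz gives (tr √ρ)² ≤ d, hence q ≥ 0. Hölder gives (tr √ρ)² ≥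
1 / tr ρ², and Jensen together with the mean purity (d + m)/(dm + 1) gives q ≤ 1/(d(d + m)).

Upper bound: factor J = K K'* through its singular value decomposition, with K K* + K' K'* of trace
2‖J‖₁. Then 2‖BJB‖₁ ≤ tr(B²(K K* + K' K'*)) for Hermitian B (`exists_traceNorm_compression_le`), and
B = 1 ⊗ sᵀ has E B² = 1/d.

Lower bound: E Y = (1/d − dq) J + q T(J), where T is the partial trace over the second register
followed by tensoring with the identity. If the unitary W attains tr(WJ) = ‖J‖₁, the test matrix V =
W − qd T(W) cancels the T(J) contribution and has operator norm at most 1 + d²q. Duality gives (1 −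
d²q)‖J‖₁/d ≤ (1 + d²q) E‖Y‖₁, and the bound on q turns this into the factor m/(2d + m). -/

namespace AcidNorm

/-! ### Singular values, trace norm duality and continuity. -/

section TraceNorm

open scoped Matrix.Norms.L2Operator

variable {ι : Type*} [Fintype ι] [DecidableEq ι]

/-- Singular value decomposition of a linear map: orthonormal bases `b`, `u` with
`T (b i) = σ i • u i`. -/
theorem exists_orthonormalBasis_singularValues {E : Type*} [NormedAddCommGroup E]
    [InnerProductSpace ℂ E] [FiniteDimensional ℂ E] (T : E →ₗ[ℂ] E) {N : ℕ}
    (hN : Module.finrank ℂ E = N) :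
    ∃ b u : OrthonormalBasis (Fin N) ℂ E,
      ∀ i, T (b i) = ((T.singularValues i : ℝ) : ℂ) • u i := by
  have hT := T.isSymmetric_adjoint_comp_self
  let b := hT.eigenvectorBasis hN
  have hinner : ∀ i j, inner ℂ (T (b i)) (T (b j))
      = if i = j then ((T.singularValues i : ℝ) : ℂ) ^ 2 else 0 := by
    intro i j
    have h1 : inner ℂ (T (b i)) (T (b j)) = inner ℂ (b i) ((T.adjoint ∘ₗ T) (b j)) := by
      rw [LinearMap.comp_apply, LinearMap.adjoint_inner_right]
    rw [h1, hT.apply_eigenvectorBasis hN j, inner_smul_right,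
      orthonormal_iff_ite.mp b.orthonormal i j, ← T.sq_singularValues_fin hN]
    split_ifs with h
    · subst h; simp
    · simp
  let v : Fin N → E := fun i => (((T.singularValues i : ℝ) : ℂ)⁻¹) • T (b i)
  let s : Set (Fin N) := {i | T.singularValues i ≠ 0}
  -- The normalized images are orthonormal only where the singular value is nonzero; the kernel
  -- directions are filled in by extending to a basis.
  have hv : Orthonormal ℂ (s.domRestrict v) := by
    rw [orthonormal_iff_ite]
    rintro ⟨i, hi⟩ ⟨j, hj⟩
    have hi' : ((T.singularValues i : ℝ) : ℂ) ≠ 0 := by exact_mod_cast hi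
    simp only [Set.domRestrict_apply, v, inner_smul_left, inner_smul_right, hinner, Subtype.mk.injEq]
    split_ifs with h
    · subst h
      simp only [map_inv₀, Complex.conj_ofReal]
      field_simp
    · simp
  obtain ⟨u, hu⟩ := hv.exists_orthonormalBasis_extension_of_card_eq (by simpa using hN)
  refine ⟨b, u, fun i => ?_⟩
  by_cases hi : T.singularValues i = 0
  · have : inner ℂ (T (b i)) (T (b i)) = 0 := by rw [hinner]; simp [hi]
    rw [hi, inner_self_eq_zero.mp this]
    simp
  · rw [hu i hi]
    have hi' : ((T.singularValues i : ℝ) : ℂ) ≠ 0 := by exact_mod_cast hi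
    simp [v, smul_smul, hi']

theorem exists_svd (A : Matrix ι ι ℂ) :
    ∃ U ∈ Matrix.unitaryGroup ι ℂ, ∃ V ∈ Matrix.unitaryGroup ι ℂ, ∃ σ : ι → ℝ,
      (∀ i, 0 ≤ σ i) ∧ A = U * Matrix.diagonal (fun i => (σ i : ℂ)) * Vᴴ ∧
        ∑ i, σ i = traceNorm A := by
  obtain ⟨b, u, hbu⟩ := exists_orthonormalBasis_singularValues (Matrix.toEuclideanLin A)
    (N := Fintype.card ι) (by simp)
  let e : Fin (Fintype.card ι) ≃ ι := (Fintype.equivFin ι).symm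
  let b' := b.reindex e
  let u' := u.reindex e
  let B := EuclideanSpace.basisFun ι ℂ
  let σ : ι → ℝ := fun i => (Matrix.toEuclideanLin A).singularValues (e.symm i)
  have hU := B.toMatrix_orthonormalBasis_mem_unitary u'
  have hV := B.toMatrix_orthonormalBasis_mem_unitary b'
  refine ⟨_, hU, _, hV, σ, fun i => LinearMap.singularValues_nonneg _ _, ?_, ?_⟩
  · have hAV : A * B.toBasis.toMatrix b' = B.toBasis.toMatrix u' *
        Matrix.diagonal (fun i => (σ i : ℂ)) := by
      ext i j
      have h := congrArg (fun x : EuclideanSpace ℂ ι => x i) (hbu (e.symm j))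
      rw [Matrix.mul_diagonal]
      simpa [Matrix.mul_apply, Module.Basis.toMatrix_apply, B, b', u', σ, Matrix.mulVec, dotProduct,
        mul_comm] using h
    rw [← hAV, Matrix.mul_assoc, ← Matrix.star_eq_conjTranspose, (Matrix.mem_unitaryGroup_iff).mp hV,
      Matrix.mul_one]
  · rw [traceNorm, Finset.sum_range, ← e.symm.sum_comp]

theorem norm_le_one_of_mem_unitaryGroup {U : Matrix ι ι ℂ} (hU : U ∈ Matrix.unitaryGroup ι ℂ) :
    ‖U‖ ≤ 1 := by
  have h1 : ‖(1 : Matrix ι ι ℂ)‖ ≤ 1 := by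
    rw [← Matrix.diagonal_one, Matrix.l2_opNorm_diagonal]
    exact (pi_norm_le_iff_of_nonneg zero_le_one).mpr fun i => by simp
  have h2 : ‖U‖ * ‖U‖ ≤ 1 := by
    rw [← Matrix.l2_opNorm_conjTranspose_mul_self, ← Matrix.star_eq_conjTranspose,
      Matrix.mem_unitaryGroup_iff'.mp hU]
    exact h1
  nlinarith [norm_nonneg U]

theorem norm_apply_le_norm (A : Matrix ι ι ℂ) (i j : ι) : ‖A i j‖ ≤ ‖A‖ := by
  have h := Matrix.l2_opNorm_mulVec A (EuclideanSpace.single j (1 : ℂ))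
  have h2 := PiLp.norm_apply_le (p := 2) (WithLp.toLp 2 (A *ᵥ (EuclideanSpace.single j (1 : ℂ)))) i
  simp at h h2
  exact h2.trans h

theorem exists_trace_mul_eq_traceNorm (A : Matrix ι ι ℂ) :
    ∃ W ∈ Matrix.unitaryGroup ι ℂ, (W * A).trace = traceNorm A := by
  obtain ⟨U, hU, V, hV, σ, -, hA, hs⟩ := exists_svd A
  refine ⟨V * Uᴴ, mul_mem hV (Unitary.star_mem hU), ?_⟩
  have : V * Uᴴ * A = V * Matrix.diagonal (fun i => (σ i : ℂ)) * Vᴴ := by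
    rw [hA]
    have h := Matrix.mem_unitaryGroup_iff'.mp hU
    rw [Matrix.star_eq_conjTranspose] at h
    calc _ = V * (Uᴴ * U) * Matrix.diagonal (fun i => (σ i : ℂ)) * Vᴴ := by
          simp only [Matrix.mul_assoc]
      _ = _ := by rw [h, Matrix.mul_one]
  rw [this, Matrix.trace_mul_comm, ← Matrix.mul_assoc, ← Matrix.star_eq_conjTranspose,
    Matrix.mem_unitaryGroup_iff'.mp hV, Matrix.one_mul, Matrix.trace_diagonal, ← hs]
  push_cast
  rfl

/-- Hölder duality: in the singular bases the trace is a sum of singular values weighted by diagonal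
entries of Vᴴ X U, each at most ‖X‖ in modulus. -/
theorem norm_trace_mul_le (X A : Matrix ι ι ℂ) : ‖(X * A).trace‖ ≤ ‖X‖ * traceNorm A := by
  obtain ⟨U, hU, V, hV, σ, hσ, hA, hs⟩ := exists_svd A
  have h1 : (X * A).trace = (Vᴴ * X * U * Matrix.diagonal (fun i => (σ i : ℂ))).trace := by
    rw [hA, ← Matrix.mul_assoc, Matrix.trace_mul_comm]
    simp only [Matrix.mul_assoc]
  have hn : ‖Vᴴ * X * U‖ ≤ ‖X‖ := by
    have h2 := norm_le_one_of_mem_unitaryGroup hU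
    have h3 : ‖Vᴴ‖ ≤ 1 := by
      rw [Matrix.l2_opNorm_conjTranspose]
      exact norm_le_one_of_mem_unitaryGroup hV
    calc ‖Vᴴ * X * U‖ ≤ ‖Vᴴ‖ * ‖X‖ * ‖U‖ :=
          (norm_mul_le _ _).trans (mul_le_mul_of_nonneg_right (norm_mul_le _ _) (norm_nonneg _))
      _ ≤ 1 * ‖X‖ * 1 := by gcongr
      _ = ‖X‖ := by ring
  rw [h1, ← hs, Finset.mul_sum, Matrix.trace]
  refine (norm_sum_le _ _).trans (Finset.sum_le_sum fun i _ => ?_)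
  rw [Matrix.diag_apply, Matrix.mul_diagonal, norm_mul, Complex.norm_of_nonneg (hσ i)]
  exact mul_le_mul_of_nonneg_right ((norm_apply_le_norm _ _ _).trans hn) (hσ i)

theorem traceNorm_nonneg (A : Matrix ι ι ℂ) : 0 ≤ traceNorm A :=
  Finset.sum_nonneg fun _ _ => LinearMap.singularValues_nonneg _ _

theorem traceNorm_smul (c : ℝ) (hc : 0 ≤ c) (A : Matrix ι ι ℂ) :
    traceNorm ((c : ℂ) • A) = c * traceNorm A := by
  apply le_antisymm
  · obtain ⟨W, hW, h⟩ := exists_trace_mul_eq_traceNorm ((c : ℂ) • A)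
    have h1 : traceNorm ((c : ℂ) • A) = ‖(W * ((c : ℂ) • A)).trace‖ := by
      rw [h, Complex.norm_of_nonneg (traceNorm_nonneg _)]
    rw [h1, Matrix.mul_smul, Matrix.trace_smul, norm_smul, Complex.norm_of_nonneg hc]
    gcongr
    exact (norm_trace_mul_le W A).trans
      (mul_le_of_le_one_left (traceNorm_nonneg A) (norm_le_one_of_mem_unitaryGroup hW))
  · obtain ⟨W, hW, h⟩ := exists_trace_mul_eq_traceNorm A
    have h1 : c * traceNorm A = ‖(W * ((c : ℂ) • A)).trace‖ := by
      rw [Matrix.mul_smul, Matrix.trace_smul, norm_smul, Complex.norm_of_nonneg hc, h,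
        Complex.norm_of_nonneg (traceNorm_nonneg _)]
    rw [h1]
    exact (norm_trace_mul_le W _).trans
      (mul_le_of_le_one_left (traceNorm_nonneg _) (norm_le_one_of_mem_unitaryGroup hW))

/-- A crude Lipschitz bound, obtained by testing with the unitary optimal for A; it serves only to
give continuity, hence measurability and integrability. -/
theorem traceNorm_sub_le (A B : Matrix ι ι ℂ) :
    traceNorm A - traceNorm B ≤ Fintype.card ι * ‖A - B‖ := by
  obtain ⟨W, hW, h⟩ := exists_trace_mul_eq_traceNorm A
  have hW1 := norm_le_one_of_mem_unitaryGroup hW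
  have h1 : (traceNorm A : ℂ) = (W * B).trace + (W * (A - B)).trace := by
    rw [← h, Matrix.mul_sub, Matrix.trace_sub]; ring
  have h2 : traceNorm A ≤ ‖(W * B).trace‖ + ‖(W * (A - B)).trace‖ := by
    rw [← Complex.norm_of_nonneg (traceNorm_nonneg A), h1]
    exact norm_add_le _ _
  have h3 := (norm_trace_mul_le W B).trans (mul_le_of_le_one_left (traceNorm_nonneg _) hW1)
  have h4 : ‖(W * (A - B)).trace‖ ≤ Fintype.card ι * ‖A - B‖ := by
    have h5 : ‖W * (A - B)‖ ≤ ‖A - B‖ :=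
      (norm_mul_le _ _).trans (mul_le_of_le_one_left (norm_nonneg _) hW1)
    refine (norm_sum_le _ _).trans ?_
    refine (Finset.sum_le_sum fun i _ => (norm_apply_le_norm _ i i).trans h5).trans ?_
    simp
  linarith

theorem continuous_traceNorm : Continuous (traceNorm : Matrix ι ι ℂ → ℝ) := by
  have : LipschitzWith (Fintype.card ι) (traceNorm : Matrix ι ι ℂ → ℝ) := by
    refine LipschitzWith.of_le_add_mul _ fun A B => ?_
    have := traceNorm_sub_le A B
    rw [dist_eq_norm]
    simp only [NNReal.coe_natCast]
    linarith
  exact this.continuous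

end TraceNorm

end AcidNorm

theorem Equiv.Perm.exists_apply_eq_apply_eq {ι : Type*} [DecidableEq ι] {x y i k : ι} (hxy : x ≠ y) (hik : i ≠ k) :
    ∃ π : Equiv.Perm ι, π x = i ∧ π y = k := by
  have hy : Equiv.swap x i y ≠ i := fun h => hxy (by
    have := congrArg (Equiv.swap x i) h
    simpa using this.symm)
  refine ⟨(Equiv.swap x i).trans (Equiv.swap (Equiv.swap x i y) k), ?_, ?_⟩
  · simp [Equiv.swap_apply_of_ne_of_ne hy.symm hik]
  · simp

namespace AcidNorm

/-! ### Four-index tensors invariant under unitary conjugation. -/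

section SecondMoment

variable {ι : Type*} [Fintype ι] [DecidableEq ι]

/-- Invariance of a four-index tensor under `U ⊗ conj U ⊗ U ⊗ conj U`. -/
def IsConjInvariant (M : ι → ι → ι → ι → ℂ) : Prop :=
  ∀ U ∈ Matrix.unitaryGroup ι ℂ, ∀ i j k l, M i j k l =
    ∑ a, U i a * ∑ b, star (U j b) * ∑ c, U k c * ∑ e, star (U l e) * M a b c e

namespace IsConjInvariant

variable {M : ι → ι → ι → ι → ℂ}

/-- Invariance under permutation matrices with phases, which collapses the fourfold sum to one term.
Apart from one plane rotation, these are all the unitaries needed. -/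
theorem monomial (hM : IsConjInvariant M) (z : ι → ℂ) (hz : ∀ i, z i * star (z i) = 1)
    (π : Equiv.Perm ι) (i j k l : ι) :
    M i j k l = z i * star (z j) * z k * star (z l) * M (π i) (π j) (π k) (π l) := by
  let U : Matrix ι ι ℂ := Matrix.of fun i a => if a = π i then z i else 0
  have hU : U ∈ Matrix.unitaryGroup ι ℂ := by
    rw [Matrix.mem_unitaryGroup_iff]
    ext p q
    rw [Matrix.mul_apply, Matrix.one_apply]
    simp only [U, Matrix.star_apply, Matrix.of_apply, ite_mul, zero_mul, Finset.sum_ite_eq',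
      Finset.mem_univ, if_true, EmbeddingLike.apply_eq_iff_eq]
    by_cases h : p = q
    · subst h; simpa using hz p
    · simp [h]
  rw [hM U hU]
  simp [U, apply_ite star, ite_mul]
  ring

theorem perm (hM : IsConjInvariant M) (π : Equiv.Perm ι) (i j k l : ι) :
    M i j k l = M (π i) (π j) (π k) (π l) := by
  simpa using hM.monomial (fun _ => 1) (by simp) π i j k l

theorem eq_zero (hM : IsConjInvariant M) {i j k l : ι}
    (h : ¬ (i = j ∧ k = l)) (h' : ¬ (i = l ∧ j = k)) : M i j k l = 0 := by
  -- The phase is i rather than −1 because an index may occur in both unconjugated positions: there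
  -- i² = −1 still forces vanishing, whereas (−1)² = 1 would not.
  have key : ∀ w : ι, M i j k l = (if i = w then Complex.I else 1)
      * star (if j = w then Complex.I else 1) * (if k = w then Complex.I else 1)
      * star (if l = w then Complex.I else 1) * M i j k l := fun w =>
    hM.monomial (fun i => if i = w then Complex.I else 1)
      (fun i => by split_ifs <;> simp) 1 i j k l
  have hI : ∀ c x : ℂ, x = c * x → c ≠ 1 → x = 0 := fun c x hx hc => by
    have : (c - 1) * x = 0 := by linear_combination -hx
    exact (mul_eq_zero.mp this).resolve_left (sub_ne_zero.mpr hc)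
  have hI1 : Complex.I ≠ 1 := fun h => by simpa using congrArg Complex.im h
  by_cases hij : i = j
  · subst hij
    have hkl : l ≠ k := fun hkl => h ⟨rfl, hkl.symm⟩
    refine hI _ _ (key k) ?_
    by_cases hik : i = k <;> simp [hik, hkl, hI1]
  · by_cases hil : i = l
    · subst hil
      have hjk : j ≠ k := fun hjk => h' ⟨rfl, hjk⟩
      refine hI _ _ (key k) ?_
      by_cases hik : i = k <;> simp [hik, hjk, hI1]
    · refine hI _ _ (key i) ?_
      have h1 : j ≠ i := fun h => hij h.symm
      have h2 : l ≠ i := fun h => hil h.symm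
      by_cases hik : k = i
      · simp only [hik, h1, h2, if_true, if_false, star_one, mul_one, Complex.I_mul_I]
        norm_num
      · simp [hik, h1, h2, hI1]

/-- Rotate by 45° in the plane of x and y. Of the sixteen resulting terms, each with weight 1/4, six
survive and agree in pairs by the swap symmetry, so M x x x x is half the sum of itself and the two
terms on the right. -/
theorem diag_eq (hM : IsConjInvariant M) {x y : ι} (hxy : x ≠ y) :
    M x x x x = M x x y y + M x y y x := by
  let c : ℂ := ((√2)⁻¹ : ℝ)
  have hc : c * c = 1 / 2 := by
    simp only [c]
    rw [← Complex.ofReal_mul, ← mul_inv, Real.mul_self_sqrt (by norm_num)]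
    norm_num
  have hcs : star c = c := Complex.conj_ofReal _
  let U : Matrix ι ι ℂ := Matrix.of fun i a =>
    if i = x then (if a = x then c else if a = y then c else 0) else
    if i = y then (if a = x then -c else if a = y then c else 0) else
    if a = i then 1 else 0
  have hsum : ∀ (p q : ℂ) (f : ι → ℂ),
      ∑ a, (if a = x then p else if a = y then q else 0) * f a = p * f x + q * f y := by
    intro p q f
    have : ∀ a, (if a = x then p else if a = y then q else 0) * f a
        = (if a = x then p * f x else 0) + (if a = y then q * f y else 0) := by
      intro a
      by_cases h1 : a = x
      · subst h1; simp [hxy]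
      · by_cases h2 : a = y
        · subst h2; simp [h1]
        · simp [h1, h2]
    simp [this, Finset.sum_add_distrib]
  have hU : U ∈ Matrix.unitaryGroup ι ℂ := by
    rw [Matrix.mem_unitaryGroup_iff]
    ext p q
    rw [Matrix.mul_apply, Matrix.one_apply]
    simp only [U, Matrix.star_apply, Matrix.of_apply]
    by_cases hpx : p = x
    · simp only [hpx, if_true, hsum]
      by_cases hqx : q = x
      · simp [hqx, hxy.symm, hcs, hc]; norm_num
      · by_cases hqy : q = y
        · simp [hqy, hxy.symm, hxy, hcs]
        · simp [hqx, hqy, Ne.symm hqx, Ne.symm hqy]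
    · by_cases hpy : p = y
      · simp only [hpy, hxy.symm, if_true, if_false, hsum]
        by_cases hqx : q = x
        · simp [hqx, hxy.symm, hcs]
        · by_cases hqy : q = y
          · simp [hqy, hxy.symm, hcs, hc]; norm_num
          · simp [hqx, hqy, Ne.symm hqx, Ne.symm hqy]
      · simp only [hpx, hpy, if_false, ite_mul, one_mul, zero_mul, Finset.sum_ite_eq',
          Finset.mem_univ, if_true]
        by_cases hqx : q = x
        · simp [hqx, hpx]
        · by_cases hqy : q = y
          · simp [hqy, hpy, hxy.symm]
          · by_cases hpq : p = q <;> simp [hqx, hqy, hpq]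
  have hrow : ∀ f : ι → ℂ, ∑ a, U x a * f a = c * (f x + f y) := by
    intro f
    simp only [U, Matrix.of_apply, if_true, hsum]
    ring
  have hrow' : ∀ f : ι → ℂ, ∑ a, star (U x a) * f a = c * (f x + f y) := by
    intro f
    have : ∀ a, star (U x a) = U x a := by
      intro a
      simp only [U, Matrix.of_apply, if_true]
      split_ifs <;> simp [hcs]
    simp only [this, hrow]
  have h := hM U hU x x x x
  simp only [hrow, hrow'] at h
  have e1 := hM.perm (Equiv.swap x y) x x x x
  have e2 := hM.perm (Equiv.swap x y) x x y y
  have e3 := hM.perm (Equiv.swap x y) x y y x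
  simp only [Equiv.swap_apply_left, Equiv.swap_apply_right] at e1 e2 e3
  have z : ∀ i j k l, ¬ (i = j ∧ k = l) → ¬ (i = l ∧ j = k) → M i j k l = 0 :=
    fun i j k l h1 h2 => hM.eq_zero h1 h2
  rw [z x x x y (by simp [hxy]) (by simp [hxy]), z x x y x (by simp [hxy.symm]) (by simp [hxy]),
    z x y x x (by simp [hxy]) (by simp [hxy.symm]), z y x x x (by simp [hxy.symm]) (by simp [hxy.symm]),
    z y y y x (by simp [hxy.symm]) (by simp [hxy.symm]), z y y x y (by simp [hxy]) (by simp [hxy.symm]),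
    z y x y y (by simp [hxy.symm]) (by simp [hxy]), z x y y y (by simp [hxy]) (by simp [hxy]),
    z x y x y (by simp [hxy]) (by simp [hxy]), z y x y x (by simp [hxy.symm]) (by simp [hxy.symm]),
    ← e1, ← e2, ← e3] at h
  linear_combination 2 * h + (2 * c * c + 1) * (2 * M x x x x + 2 * M x x y y + 2 * M x y y x) * hc

/-- The commutant of `U ⊗ U` is spanned by the identity and the swap. -/
theorem exists_eq [Nontrivial ι] (hM : IsConjInvariant M) :
    ∃ P Q : ℂ, ∀ i j k l, M i j k l =
      P * ((if i = j then 1 else 0) * (if k = l then 1 else 0))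
        + Q * ((if i = l then 1 else 0) * (if j = k then 1 else 0)) := by
  obtain ⟨x, y, hxy⟩ := exists_pair_ne ι
  refine ⟨M x x y y, M x y y x, fun i j k l => ?_⟩
  by_cases h : i = j ∧ k = l
  · obtain ⟨rfl, rfl⟩ := h
    by_cases hik : i = k
    · subst hik
      have := hM.perm (Equiv.swap x i) x x x x
      simp only [Equiv.swap_apply_left] at this
      rw [← this, hM.diag_eq hxy]
      simp
    · obtain ⟨π, h1, h2⟩ := Equiv.Perm.exists_apply_eq_apply_eq hxy hik
      rw [hM.perm π x x y y, h1, h2]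
      simp [hik]
  · by_cases h' : i = l ∧ j = k
    · obtain ⟨rfl, rfl⟩ := h'
      have hij : i ≠ j := fun e => h ⟨e, e.symm⟩
      obtain ⟨π, h1, h2⟩ := Equiv.Perm.exists_apply_eq_apply_eq hxy hij
      rw [hM.perm π x y y x, h1, h2]
      simp [hij]
    · rw [hM.eq_zero h h']
      have e1 : ((if i = j then 1 else 0) * (if k = l then 1 else 0) : ℂ) = 0 := by
        rw [not_and_or] at h; rcases h with h | h <;> simp [h]
      have e2 : ((if i = l then 1 else 0) * (if j = k then 1 else 0) : ℂ) = 0 := by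
        rw [not_and_or] at h'; rcases h' with h | h <;> simp [h]
      rw [e1, e2]; simp

end IsConjInvariant

theorem isConjInvariant_integral {Ω : Type*} [MeasurableSpace Ω] {P : Measure Ω}
    {A : Ω → Matrix ι ι ℂ} (hint : ∀ i j k l, Integrable (fun ω => A ω i j * A ω k l) P)
    (hA : ∀ U ∈ Matrix.unitaryGroup ι ℂ, ∀ i j k l,
      ∫ ω, (U * A ω * Uᴴ) i j * (U * A ω * Uᴴ) k l ∂P = ∫ ω, A ω i j * A ω k l ∂P) :
    IsConjInvariant fun i j k l => ∫ ω, A ω i j * A ω k l ∂P := by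
  intro U hU i j k l
  beta_reduce
  rw [← hA U hU]
  have expand : ∀ ω, (U * A ω * Uᴴ) i j * (U * A ω * Uᴴ) k l =
      ∑ a, U i a * ∑ b, star (U j b) * ∑ c, U k c * ∑ e, star (U l e)
        * (A ω a b * A ω c e) := by
    intro ω
    have h1 : ∀ p q, (U * A ω * Uᴴ) p q = ∑ a, U p a * ∑ b, star (U q b) * A ω a b := by
      intro p q
      rw [Matrix.mul_assoc, Matrix.mul_apply]
      refine Finset.sum_congr rfl fun a _ => ?_
      rw [Matrix.mul_apply]
      simp [mul_comm]
    rw [h1, h1, Finset.sum_mul]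
    refine Finset.sum_congr rfl fun a _ => ?_
    rw [mul_assoc, Finset.sum_mul]
    congr 1
    refine Finset.sum_congr rfl fun b _ => ?_
    rw [mul_assoc, Finset.mul_sum]
    congr 1
    refine Finset.sum_congr rfl fun c _ => ?_
    rw [mul_left_comm, Finset.mul_sum]
    congr 1
    refine Finset.sum_congr rfl fun e _ => ?_
    ring
  simp only [expand]
  have i4 : ∀ a b c e, Integrable (fun ω => star (U l e) * (A ω a b * A ω c e)) P :=
    fun a b c e => (hint a b c e).const_mul _
  have i3 : ∀ a b c, Integrable (fun ω => U k c * ∑ e, star (U l e) * (A ω a b * A ω c e)) P :=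
    fun a b c => (integrable_finsetSum _ fun e _ => i4 a b c e).const_mul _
  have i2 : ∀ a b, Integrable (fun ω => star (U j b) * ∑ c, U k c * ∑ e, star (U l e)
      * (A ω a b * A ω c e)) P :=
    fun a b => (integrable_finsetSum _ fun c _ => i3 a b c).const_mul _
  have i1 : ∀ a, Integrable (fun ω => U i a * ∑ b, star (U j b) * ∑ c, U k c * ∑ e, star (U l e)
      * (A ω a b * A ω c e)) P :=
    fun a => (integrable_finsetSum _ fun b _ => i2 a b).const_mul _
  rw [integral_finsetSum _ fun a _ => i1 a]
  refine Finset.sum_congr rfl fun a _ => ?_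
  rw [integral_const_mul, integral_finsetSum _ fun b _ => i2 a b]
  congr 1
  refine Finset.sum_congr rfl fun b _ => ?_
  rw [integral_const_mul, integral_finsetSum _ fun c _ => i3 a b c]
  congr 1
  refine Finset.sum_congr rfl fun c _ => ?_
  rw [integral_const_mul, integral_finsetSum _ fun e _ => i4 a b c e]
  congr 1
  refine Finset.sum_congr rfl fun e _ => ?_
  rw [integral_const_mul]

end SecondMoment

/-! ### Haar random pure states and their second moment. -/

section HaarState

variable {ι : Type*}

/-- The rank-one operator `|ψ⟩⟨ψ|`. -/
def rankOne (ψ : EuclideanSpace ℂ ι) : Matrix ι ι ℂ :=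
  Matrix.vecMulVec (fun p => ψ p) (star fun p => ψ p)

theorem rankOne_apply (ψ : EuclideanSpace ℂ ι) (i j : ι) : rankOne ψ i j = ψ i * star (ψ j) := rfl

theorem continuous_rankOne_apply (i j : ι) :
    Continuous fun ψ : EuclideanSpace ℂ ι => rankOne ψ i j := by
  simp only [rankOne_apply]
  fun_prop

variable [Fintype ι]

/-- A continuous function is bounded on the compact unit sphere, where the state lies almost surely.
-/
theorem IsHaarRandomState.integrable_comp {Ω : Type*} [MeasurableSpace Ω] {P : Measure Ω}
    [IsProbabilityMeasure P] {ψ : Ω → EuclideanSpace ℂ ι} (hψ : IsHaarRandomState P ψ)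
    {F : Type*} [NormedAddCommGroup F] {f : EuclideanSpace ℂ ι → F} (hf : Continuous f) :
    Integrable (fun ω => f (ψ ω)) P := by
  obtain ⟨C, hC⟩ := (isCompact_sphere (0 : EuclideanSpace ℂ ι) 1).exists_bound_of_continuousOn
    hf.continuousOn
  refine Integrable.of_bound (hf.comp_aestronglyMeasurable hψ.aemeasurable.aestronglyMeasurable)
    C ?_
  filter_upwards [hψ.norm_eq_one] with ω hω
  exact hC _ (by simpa using hω)

theorem IsHaarRandomState.integral_comp_unitary {Ω : Type*} [MeasurableSpace Ω] {P : Measure Ω}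
    {ψ : Ω → EuclideanSpace ℂ ι} (hψ : IsHaarRandomState P ψ)
    (U : EuclideanSpace ℂ ι ≃ₗᵢ[ℂ] EuclideanSpace ℂ ι)
    {f : EuclideanSpace ℂ ι → ℂ} (hf : Continuous f) :
    ∫ ω, f (U (ψ ω)) ∂P = ∫ ω, f (ψ ω) ∂P :=
  ((hψ.unitary_invariant U).comp hf.measurable).integral_eq

theorem sum_mul_star_of_norm_eq_one {ψ : EuclideanSpace ℂ ι} (h : ‖ψ‖ = 1) :
    ∑ i, ψ i * star (ψ i) = 1 := by
  have h1 := EuclideanSpace.norm_sq_eq ψ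
  rw [h] at h1
  have h2 : ∀ i, ψ i * star (ψ i) = ((‖ψ i‖ ^ 2 : ℝ) : ℂ) := fun i => by
    have := Complex.mul_conj' (ψ i)
    push_cast
    exact this
  simp only [h2]
  rw [← Complex.ofReal_sum, ← h1]
  norm_num

variable [DecidableEq ι]

/-- The isometry of Euclidean space given by a unitary matrix. -/
noncomputable def unitaryIsometry (U : Matrix.unitaryGroup ι ℂ) :
    EuclideanSpace ℂ ι ≃ₗᵢ[ℂ] EuclideanSpace ℂ ι :=
  Unitary.linearIsometryEquiv 
    ⟨Matrix.toEuclideanCLM (n := ι) (𝕜 := ℂ) U, Unitary.map_mem _ U.2⟩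

theorem unitaryIsometry_apply (U : Matrix.unitaryGroup ι ℂ) (x : EuclideanSpace ℂ ι) (i : ι) :
    unitaryIsometry U x i = ∑ j, (U : Matrix ι ι ℂ) i j * x j := by
  change (Matrix.toEuclideanCLM (n := ι) (𝕜 := ℂ) (U : Matrix ι ι ℂ) x) i = _
  rw [Matrix.ofLp_toEuclideanCLM]
  rfl

theorem rankOne_unitaryIsometry (U : Matrix.unitaryGroup ι ℂ) (ψ : EuclideanSpace ℂ ι) :
    rankOne (unitaryIsometry U ψ) = (U : Matrix ι ι ℂ) * rankOne ψ * (U : Matrix ι ι ℂ)ᴴ := by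
  ext i j
  rw [Matrix.mul_assoc, Matrix.mul_apply]
  simp only [Matrix.mul_apply, rankOne_apply, unitaryIsometry_apply, star_sum, star_mul',
    Matrix.conjTranspose_apply, Finset.sum_mul, Finset.mul_sum]
  rw [Finset.sum_comm]
  refine Finset.sum_congr rfl fun a _ => Finset.sum_congr rfl fun b _ => ?_
  ring

/-- Second moment of a Haar random pure state. -/
theorem IsHaarRandomState.integral_rankOne_mul_rankOne [Nontrivial ι] {Ω : Type*}
    [MeasurableSpace Ω] {P : Measure Ω} [IsProbabilityMeasure P]
    {ψ : Ω → EuclideanSpace ℂ ι} (hψ : IsHaarRandomState P ψ) (i j k l : ι) :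
    ∫ ω, rankOne (ψ ω) i j * rankOne (ψ ω) k l ∂P =
      ((Fintype.card ι : ℂ) * (Fintype.card ι + 1))⁻¹ *
        ((if i = j then 1 else 0) * (if k = l then 1 else 0)
          + (if i = l then 1 else 0) * (if j = k then 1 else 0)) := by
  have hcont : ∀ i j k l, Continuous fun φ : EuclideanSpace ℂ ι => rankOne φ i j * rankOne φ k l :=
    fun i j k l => (continuous_rankOne_apply i j).mul (continuous_rankOne_apply k l)
  have hint : ∀ i j k l, Integrable (fun ω => rankOne (ψ ω) i j * rankOne (ψ ω) k l) P :=
    fun i j k l => hψ.integrable_comp (hcont i j k l)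
  have hinv : IsConjInvariant fun i j k l => ∫ ω, rankOne (ψ ω) i j * rankOne (ψ ω) k l ∂P := by
    refine isConjInvariant_integral hint fun U hU i j k l => ?_
    rw [← hψ.integral_comp_unitary (unitaryIsometry ⟨U, hU⟩) (hcont i j k l)]
    simp only [rankOne_unitaryIsometry]
  obtain ⟨a, b, hab⟩ := hinv.exists_eq
  have hone : ∀ᵐ ω ∂P, ∑ i, ψ ω i * star (ψ ω i) = 1 := by
    filter_upwards [hψ.norm_eq_one] with ω hω using sum_mul_star_of_norm_eq_one hω
  have e1 : ∑ i, ∑ k, ∫ ω, rankOne (ψ ω) i i * rankOne (ψ ω) k k ∂P = 1 := by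
    simp_rw [← integral_finsetSum _ fun k _ => hint _ _ _ k]
    rw [← integral_finsetSum _ fun i _ => integrable_finsetSum _ fun k _ => hint _ _ _ _]
    have : ∀ᵐ ω ∂P, ∑ i, ∑ k, rankOne (ψ ω) i i * rankOne (ψ ω) k k = 1 := by
      filter_upwards [hone] with ω hω
      simp only [rankOne_apply, ← Finset.mul_sum, hω, mul_one]
    rw [integral_congr_ae this]
    simp
  have e2 : ∑ i, ∑ k, ∫ ω, rankOne (ψ ω) i k * rankOne (ψ ω) k i ∂P = 1 := by
    simp_rw [← integral_finsetSum _ fun k _ => hint _ _ k _]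
    rw [← integral_finsetSum _ fun i _ => integrable_finsetSum _ fun k _ => hint _ _ _ _]
    have : ∀ᵐ ω ∂P, ∑ i, ∑ k, rankOne (ψ ω) i k * rankOne (ψ ω) k i = 1 := by
      filter_upwards [hone] with ω hω
      have : ∀ i k, rankOne (ψ ω) i k * rankOne (ψ ω) k i
          = (ψ ω i * star (ψ ω i)) * (ψ ω k * star (ψ ω k)) := fun i k => by
        simp only [rankOne_apply]; ring
      simp only [this, ← Finset.mul_sum, hω, mul_one]
    rw [integral_congr_ae this]
    simp
  -- With N the dimension, the two contractions read N²a + Nb = 1 and Na + N²b = 1; since N > 1 this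
  -- forces a = b.
  simp only [hab] at e1 e2
  simp [Finset.sum_add_distrib] at e1 e2
  have hN : (Fintype.card ι : ℂ) ≠ 0 := by simp
  have hN1 : (Fintype.card ι : ℂ) + 1 ≠ 0 := Nat.cast_add_one_ne_zero _
  have hN2 : (Fintype.card ι : ℂ) - 1 ≠ 0 := by
    have := Fintype.one_lt_card (α := ι)
    rw [sub_ne_zero]; exact_mod_cast this.ne'
  have hba : a = b := by
    have : (Fintype.card ι : ℂ) * (Fintype.card ι - 1) * (a - b) = 0 := by
      linear_combination e1 - e2
    rcases mul_eq_zero.mp this with h | h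
    · exact absurd h (mul_ne_zero hN hN2)
    · exact sub_eq_zero.mp h
  have hb : b = ((Fintype.card ι : ℂ) * (Fintype.card ι + 1))⁻¹ := by
    refine eq_inv_of_mul_eq_one_left ?_
    subst hba
    linear_combination e1
  rw [hab, hba, hb]
  ring

end HaarState

open scoped ComplexOrder

/-! ### Positive semidefinite matrices and their square roots. -/

section Spectral

variable {ι : Type*} [Fintype ι] [DecidableEq ι]

theorem exists_diagonal_of_posSemidef {s : Matrix ι ι ℂ} (hs : s.PosSemidef) :
    ∃ U ∈ Matrix.unitaryGroup ι ℂ, ∃ l : ι → ℝ, (∀ i, 0 ≤ l i) ∧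
      s = U * Matrix.diagonal (fun i => (l i : ℂ)) * Uᴴ := by
  refine ⟨hs.isHermitian.eigenvectorUnitary, Subtype.property _, hs.isHermitian.eigenvalues,
    hs.eigenvalues_nonneg, ?_⟩
  conv_lhs => rw [hs.isHermitian.spectral_theorem]
  rfl

/-- Power trace inequalities for a positive semidefinite matrix of Hilbert–Schmidt norm one. -/
theorem trace_inequalities_of_posSemidef {s : Matrix ι ι ℂ} (hs : s.PosSemidef)
    (h1 : (s * s).trace = 1) :
    ∃ t p : ℝ, s.trace = t ∧ (s * s * (s * s)).trace = p ∧ 0 < p ∧ 1 ≤ t ^ 2 * p ∧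
      t ^ 2 ≤ Fintype.card ι := by
  obtain ⟨U, hU, l, hl, rfl⟩ := exists_diagonal_of_posSemidef hs
  have hUU : Uᴴ * U = 1 := Matrix.mem_unitaryGroup_iff'.mp hU
  have hmul : ∀ a b : ι → ℂ, (U * Matrix.diagonal a * Uᴴ) * (U * Matrix.diagonal b * Uᴴ)
      = U * Matrix.diagonal (fun i => a i * b i) * Uᴴ := by
    intro a b
    calc _ = U * Matrix.diagonal a * (Uᴴ * U) * Matrix.diagonal b * Uᴴ := by
          simp only [Matrix.mul_assoc]
      _ = _ := by rw [hUU, Matrix.mul_one, Matrix.mul_assoc U, Matrix.diagonal_mul_diagonal]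
  have htr : ∀ a : ι → ℂ, (U * Matrix.diagonal a * Uᴴ).trace = ∑ i, a i := by
    intro a
    rw [Matrix.trace_mul_comm, ← Matrix.mul_assoc, hUU, Matrix.one_mul, Matrix.trace_diagonal]
  rw [hmul, htr] at h1
  have h1' : ∑ i, l i * l i = 1 := by exact_mod_cast h1
  refine ⟨∑ i, l i, ∑ i, l i * l i * (l i * l i), ?_, ?_, ?_⟩
  · rw [htr]; push_cast; rfl
  · rw [hmul, hmul, htr]; push_cast; rfl
  set t := ∑ i, l i
  set p := ∑ i, l i * l i * (l i * l i)
  set r := ∑ i, l i * (l i * l i)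
  have ht : 0 ≤ t := Finset.sum_nonneg fun i _ => hl i
  have hp : 0 ≤ p := Finset.sum_nonneg fun i _ => mul_self_nonneg _
  have hr : 0 ≤ r := Finset.sum_nonneg fun i _ => mul_nonneg (hl i) (mul_self_nonneg _)
  -- Interpolation through the third moment: (∑ l²)² ≤ (∑ l)(∑ l³) and (∑ l³)² ≤ (∑ l²)(∑ l⁴), with
  -- ∑ l² = 1.
  have c1 : 1 ≤ t * r := by
    have := Finset.sum_sq_le_sum_mul_sum_of_sq_le_mul Finset.univ (r := fun i => l i * l i)
      (f := l) (g := fun i => l i * (l i * l i)) (fun i _ => hl i)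
      (fun i _ => mul_nonneg (hl i) (mul_self_nonneg _)) (fun i _ => by ring_nf; rfl)
    rw [h1'] at this
    simpa using this
  have c2 : r ^ 2 ≤ p := by
    have := Finset.sum_mul_sq_le_sq_mul_sq Finset.univ l (fun i => l i * l i)
    simp only [sq (l _), sq (l _ * l _), h1', one_mul] at this
    exact this
  have c3 : t ^ 2 ≤ Fintype.card ι := by
    have := Finset.sum_mul_sq_le_sq_mul_sq Finset.univ (fun _ : ι => (1 : ℝ)) l
    simpa [sq (l _), h1'] using this
  have c4 : 1 ≤ t ^ 2 * p := by
    calc (1 : ℝ) ≤ (t * r) ^ 2 := one_le_pow₀ c1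
      _ = t ^ 2 * r ^ 2 := by ring
      _ ≤ t ^ 2 * p := by gcongr
  refine ⟨hp.lt_of_ne fun h => ?_, c4, c3⟩
  rw [← h] at c4
  norm_num at c4

theorem sqrt_unitary_conj {a u : Matrix ι ι ℂ} (ha : 0 ≤ a) (hu : u ∈ Matrix.unitaryGroup ι ℂ) :
    CFC.sqrt (u * a * uᴴ) = u * CFC.sqrt a * uᴴ := by
  have huu : uᴴ * u = 1 := Matrix.mem_unitaryGroup_iff'.mp hu
  refine CFC.sqrt_unique ?_ ?_
  · calc _ = u * CFC.sqrt a * (uᴴ * u) * CFC.sqrt a * uᴴ := by simp only [Matrix.mul_assoc]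
      _ = u * (CFC.sqrt a * CFC.sqrt a) * uᴴ := by rw [huu]; simp only [Matrix.mul_assoc, Matrix.one_mul]
      _ = _ := by rw [CFC.sqrt_mul_sqrt_self a ha]
  · rw [Matrix.nonneg_iff_posSemidef]
    exact (Matrix.nonneg_iff_posSemidef.mp (CFC.sqrt_nonneg a)).mul_mul_conjTranspose_same u

end Spectral

/-! ### The reduced state: mean purity and the second moment of its square root. -/

section Reduction

variable {d m : ℕ}

theorem reduction_eq_mul (ψ : EuclideanSpace ℂ (Fin d × Fin m)) :
    reduction ψ = (Matrix.of fun i s => ψ (i, s)) * (Matrix.of fun i s => ψ (i, s))ᴴ := rfl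

theorem reduction_apply (ψ : EuclideanSpace ℂ (Fin d × Fin m)) (i j : Fin d) :
    reduction ψ i j = ∑ s, rankOne ψ (i, s) (j, s) := rfl

theorem reduction_nonneg (ψ : EuclideanSpace ℂ (Fin d × Fin m)) : 0 ≤ reduction ψ := by
  rw [Matrix.nonneg_iff_posSemidef, reduction_eq_mul]
  exact Matrix.posSemidef_self_mul_conjTranspose _

theorem posSemidef_sqrt_reduction (ψ : EuclideanSpace ℂ (Fin d × Fin m)) :
    (CFC.sqrt (reduction ψ)).PosSemidef :=
  Matrix.nonneg_iff_posSemidef.mp (CFC.sqrt_nonneg _)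

theorem trace_reduction {ψ : EuclideanSpace ℂ (Fin d × Fin m)} (h : ‖ψ‖ = 1) :
    (reduction ψ).trace = 1 := by
  rw [← sum_mul_star_of_norm_eq_one h, Fintype.sum_prod_type]
  rfl

theorem continuous_reduction :
    Continuous (reduction : EuclideanSpace ℂ (Fin d × Fin m) → Matrix (Fin d) (Fin d) ℂ) := by
  refine continuous_matrix fun i j => ?_
  simp only [reduction_apply]
  exact continuous_finsetSum _ fun s _ => continuous_rankOne_apply _ _

open scoped Matrix.Norms.L2Operator in
theorem continuous_sqrt_reduction :
    Continuous fun ψ : EuclideanSpace ℂ (Fin d × Fin m) => CFC.sqrt (reduction ψ) :=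
  CFC.continuousOn_sqrt.comp_continuous continuous_reduction reduction_nonneg

theorem reduction_kronecker_one {u : Matrix (Fin d) (Fin d) ℂ}
    (hu : Matrix.kronecker u (1 : Matrix (Fin m) (Fin m) ℂ) ∈
      Matrix.unitaryGroup (Fin d × Fin m) ℂ)
    (ψ : EuclideanSpace ℂ (Fin d × Fin m)) :
    reduction (unitaryIsometry ⟨_, hu⟩ ψ) = u * reduction ψ * uᴴ := by
  have : (Matrix.of fun i s => unitaryIsometry ⟨_, hu⟩ ψ (i, s))
      = u * Matrix.of fun i s => ψ (i, s) := by
    ext i s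
    simp only [Matrix.of_apply, unitaryIsometry_apply, Matrix.mul_apply, Fintype.sum_prod_type]
    simp [Matrix.kronecker, Matrix.kroneckerMap_apply, Matrix.one_apply]
  rw [reduction_eq_mul, reduction_eq_mul, this, Matrix.conjTranspose_mul]
  simp only [Matrix.mul_assoc]

variable {Ω : Type*} [MeasurableSpace Ω] {P : Measure Ω} [IsProbabilityMeasure P]
  {ψ : Ω → EuclideanSpace ℂ (Fin d × Fin m)}

/-- For m = 0 the space is zero and contains no unit vector. -/
theorem IsHaarRandomState.pos_right (hψ : IsHaarRandomState P ψ) : 0 < m := by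
  rcases Nat.eq_zero_or_pos m with rfl | h
  · obtain ⟨ω, hω⟩ := hψ.norm_eq_one.exists
    have : ψ ω = 0 := Subsingleton.elim _ _
    simp [this] at hω
  · exact h

/-- The expected purity of the reduction of a Haar random state. -/
theorem IsHaarRandomState.integral_trace_reduction_sq (hd : 1 < d) (hψ : IsHaarRandomState P ψ) :
    ∫ ω, (reduction (ψ ω) * reduction (ψ ω)).trace ∂P = ((d : ℂ) + m) / (d * m + 1) := by
  have hm := hψ.pos_right
  have : Nontrivial (Fin d) := Fin.nontrivial_iff_two_le.mpr hd
  have : Nonempty (Fin m) := ⟨⟨0, hm⟩⟩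
  have hcont : ∀ i j k l, Continuous fun φ : EuclideanSpace ℂ (Fin d × Fin m) =>
      rankOne φ i j * rankOne φ k l :=
    fun i j k l => (continuous_rankOne_apply i j).mul (continuous_rankOne_apply k l)
  have hint : ∀ i j k l, Integrable (fun ω => rankOne (ψ ω) i j * rankOne (ψ ω) k l) P :=
    fun i j k l => hψ.integrable_comp (hcont i j k l)
  have expand : ∀ ω, (reduction (ψ ω) * reduction (ψ ω)).trace
      = ∑ i, ∑ j, ∑ s, ∑ t, rankOne (ψ ω) (i, s) (j, s) * rankOne (ψ ω) (j, t) (i, t) := by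
    intro ω
    simp only [Matrix.trace, Matrix.diag_apply, Matrix.mul_apply, reduction_apply,
      Finset.sum_mul_sum]
  simp only [expand]
  rw [integral_finsetSum _ fun i _ => integrable_finsetSum _ fun j _ =>
    integrable_finsetSum _ fun s _ => integrable_finsetSum _ fun t _ => hint _ _ _ _]
  simp_rw [integral_finsetSum _ fun j _ =>
    integrable_finsetSum _ fun s _ => integrable_finsetSum _ fun t _ => hint (_, s) (j, s) _ _,
    integral_finsetSum _ fun s _ => integrable_finsetSum _ fun t _ => hint (_, s) (_, s) _ _,
    integral_finsetSum _ fun t _ => hint (_, _) (_, _) (_, t) (_, t),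
    hψ.integral_rankOne_mul_rankOne]
  have hd0 : (d : ℂ) ≠ 0 := by exact_mod_cast (by omega : d ≠ 0)
  have hm0 : (m : ℂ) ≠ 0 := by exact_mod_cast hm.ne'
  have h1 : (d : ℂ) * m + 1 ≠ 0 := by exact_mod_cast Nat.succ_ne_zero (d * m)
  simp only [Prod.mk.injEq, and_true, true_and]
  simp only [← Finset.mul_sum, Finset.sum_add_distrib]
  simp [eq_comm]
  field_simp
  ring

theorem IsHaarRandomState.integrable_sqrt_mul_sqrt (hψ : IsHaarRandomState P ψ)
    (i j k l : Fin d) :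
    Integrable (fun ω => CFC.sqrt (reduction (ψ ω)) i j * CFC.sqrt (reduction (ψ ω)) k l) P :=
  hψ.integrable_comp (f := fun φ => CFC.sqrt (reduction φ) i j * CFC.sqrt (reduction φ) k l)
    ((continuous_sqrt_reduction.matrix_elem i j).mul (continuous_sqrt_reduction.matrix_elem k l))

/-- Second moment of the square root of the reduction of a Haar random state. -/
theorem IsHaarRandomState.integral_sqrt_mul_sqrt (hd : 1 < d) (hψ : IsHaarRandomState P ψ) :
    ∃ q : ℝ, 0 ≤ q ∧ q * (d * (d + m)) ≤ 1 ∧ ∀ i j k l : Fin d,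
      ∫ ω, CFC.sqrt (reduction (ψ ω)) i j * CFC.sqrt (reduction (ψ ω)) k l ∂P =
        ((d : ℂ)⁻¹ - d * q) * ((if i = j then 1 else 0) * (if k = l then 1 else 0))
          + q * ((if i = l then 1 else 0) * (if j = k then 1 else 0)) := by
  have hm := hψ.pos_right
  have : Nontrivial (Fin d) := Fin.nontrivial_iff_two_le.mpr hd
  have hint := hψ.integrable_sqrt_mul_sqrt
  have hinv : IsConjInvariant fun i j k l =>
      ∫ ω, CFC.sqrt (reduction (ψ ω)) i j * CFC.sqrt (reduction (ψ ω)) k l ∂P := by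
    refine isConjInvariant_integral hint fun u hu i j k l => ?_
    -- The local unitary u ⊗ 1 conjugates ρ, and hence √ρ, by u without changing the law of the
    -- state.
    have hU : Matrix.kronecker u (1 : Matrix (Fin m) (Fin m) ℂ) ∈
        Matrix.unitaryGroup (Fin d × Fin m) ℂ :=
      Matrix.kronecker_mem_unitary hu (one_mem _)
    rw [← hψ.integral_comp_unitary (unitaryIsometry ⟨_, hU⟩)
      (f := fun φ => CFC.sqrt (reduction φ) i j * CFC.sqrt (reduction φ) k l)
      ((continuous_sqrt_reduction.matrix_elem i j).mul
        (continuous_sqrt_reduction.matrix_elem k l))]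
    simp only [reduction_kronecker_one hU, sqrt_unitary_conj (reduction_nonneg _) hu]
  obtain ⟨a, b, hab⟩ := hinv.exists_eq
  have hsq : ∀ ω, CFC.sqrt (reduction (ψ ω)) * CFC.sqrt (reduction (ψ ω)) = reduction (ψ ω) :=
    fun ω => CFC.sqrt_mul_sqrt_self _ (reduction_nonneg _)
  have hreal : ∀ᵐ ω ∂P, ∃ t p : ℝ, (CFC.sqrt (reduction (ψ ω))).trace = t ∧
      (reduction (ψ ω) * reduction (ψ ω)).trace = p ∧ 0 < p ∧ 1 ≤ t ^ 2 * p ∧ t ^ 2 ≤ d := by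
    filter_upwards [hψ.norm_eq_one] with ω hω
    have := trace_inequalities_of_posSemidef (posSemidef_sqrt_reduction (ψ ω))
      (by rw [hsq, trace_reduction hω])
    simpa [hsq] using this
  have e1 : ∑ i : Fin d, ∑ k : Fin d,
      ∫ ω, CFC.sqrt (reduction (ψ ω)) i k * CFC.sqrt (reduction (ψ ω)) k i ∂P = 1 := by
    simp_rw [← integral_finsetSum _ fun k _ => hint _ _ k _]
    rw [← integral_finsetSum _ fun i _ => integrable_finsetSum _ fun k _ => hint _ _ _ _]
    have : ∀ᵐ ω ∂P, ∑ i, ∑ k, CFC.sqrt (reduction (ψ ω)) i k * CFC.sqrt (reduction (ψ ω)) k i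
        = 1 := by
      filter_upwards [hψ.norm_eq_one] with ω hω
      have h := trace_reduction hω
      rw [← hsq] at h
      exact h
    rw [integral_congr_ae this]
    simp
  let T : Ω → ℝ := fun ω => (CFC.sqrt (reduction (ψ ω))).trace.re ^ 2
  let p : Ω → ℝ := fun ω => (reduction (ψ ω) * reduction (ψ ω)).trace.re
  have hTint : Integrable T P :=
    hψ.integrable_comp (f := fun φ => (CFC.sqrt (reduction φ)).trace.re ^ 2)
      ((Complex.continuous_re.comp continuous_sqrt_reduction.matrix_trace).pow 2)
  have hpint : Integrable p P :=
    hψ.integrable_comp (f := fun φ => (reduction φ * reduction φ).trace.re)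
      (Complex.continuous_re.comp (continuous_reduction.matrix_mul continuous_reduction).matrix_trace)
  have e2 : ∑ i : Fin d, ∑ k : Fin d,
      ∫ ω, CFC.sqrt (reduction (ψ ω)) i i * CFC.sqrt (reduction (ψ ω)) k k ∂P
        = ((∫ ω, T ω ∂P : ℝ) : ℂ) := by
    simp_rw [← integral_finsetSum _ fun k _ => hint _ _ _ k]
    rw [← integral_finsetSum _ fun i _ => integrable_finsetSum _ fun k _ => hint _ _ _ _,
      ← integral_complex_ofReal]
    refine integral_congr_ae ?_
    filter_upwards [hreal] with ω ⟨t, p, ht, _⟩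
    have : ∑ i, ∑ k, CFC.sqrt (reduction (ψ ω)) i i * CFC.sqrt (reduction (ψ ω)) k k
        = (CFC.sqrt (reduction (ψ ω))).trace ^ 2 := by
      rw [sq, Matrix.trace, Finset.sum_mul_sum]
      rfl
    rw [this]
    simp [T, ht]
  have ep : ∫ ω, p ω ∂P = ((d : ℝ) + m) / (d * m + 1) := by
    have h := hψ.integral_trace_reduction_sq hd
    have h2 : ∫ ω, (reduction (ψ ω) * reduction (ψ ω)).trace ∂P = ((∫ ω, p ω ∂P : ℝ) : ℂ) := by
      rw [← integral_complex_ofReal]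
      refine integral_congr_ae ?_
      filter_upwards [hreal] with ω ⟨t, p', _, hp, _⟩
      simp [p, hp]
    rw [h2] at h
    apply Complex.ofReal_injective
    rw [h]
    push_cast
    rfl
  have hd1 : (1 : ℝ) < d := by exact_mod_cast hd
  have hm1 : (0 : ℝ) < m := by exact_mod_cast hm
  set μ : ℝ := ((d : ℝ) + m) / (d * m + 1) with hμ
  have hμ0 : 0 < μ := by positivity
  have hT_le : ∫ ω, T ω ∂P ≤ d := by
    have : ∫ ω, T ω ∂P ≤ ∫ _, (d : ℝ) ∂P := by
      refine integral_mono_ae hTint (integrable_const _) ?_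
      filter_upwards [hreal] with ω ⟨t, p', ht, _, _, _, h⟩
      simpa [T, ht] using h
    simpa using this
  have hT_ge : 1 / μ ≤ ∫ ω, T ω ∂P := by
    -- Jensen for the convex function 1/p, through its tangent line at the mean purity μ.
    have : ∫ ω, (2 / μ - p ω / μ ^ 2) ∂P ≤ ∫ ω, T ω ∂P := by
      refine integral_mono_ae ((integrable_const _).sub (hpint.div_const _)) hTint ?_
      filter_upwards [hreal] with ω ⟨t, p', ht, hp, hp0, h, _⟩
      simp only [T, p, ht, hp, Complex.ofReal_re]
      have h1 : 1 / p' ≤ t ^ 2 := by rwa [div_le_iff₀ hp0]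
      refine le_trans ?_ h1
      rw [← sub_nonneg]
      have : 1 / p' - (2 / μ - p' / μ ^ 2) = (μ - p') ^ 2 / (p' * μ ^ 2) := by
        field_simp
        ring
      rw [this]
      positivity
    rw [integral_sub (integrable_const _) (hpint.div_const _), integral_div (μ ^ 2) p, ep] at this
    simp only [integral_const, probReal_univ, one_smul] at this
    refine le_trans (le_of_eq ?_) this
    field_simp
    ring
  set x := ∫ ω, T ω ∂P
  -- The contractions become da + d²b = 1 and d²a + db = x; eliminating a gives b = (d − x)/(d(d² −
  -- 1)), which is the witness q.
  simp only [hab] at e1 e2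
  simp [Finset.sum_add_distrib] at e1 e2
  have hdC : (d : ℂ) ≠ 0 := by exact_mod_cast (by omega : d ≠ 0)
  have hdC2 : (d : ℂ) ^ 2 - 1 ≠ 0 := by
    have : (d : ℝ) ^ 2 - 1 ≠ 0 := by nlinarith
    exact_mod_cast this
  have hd2 : 0 < (d : ℝ) ^ 2 - 1 := by nlinarith
  have hb : b = (((d - x) / (d * (d ^ 2 - 1)) : ℝ) : ℂ) := by
    push_cast
    rw [eq_div_iff (mul_ne_zero hdC hdC2)]
    linear_combination d * e1 - e2
  refine ⟨(d - x) / (d * (d ^ 2 - 1)), ?_, ?_, fun i j k l => ?_⟩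
  · have : 0 ≤ d - x := by linarith
    positivity
  · rw [div_mul_eq_mul_div, div_le_one (by positivity)]
    have h3 : (d * m + 1) / (d + m) ≤ x := by
      rwa [hμ, one_div_div] at hT_ge
    rw [div_le_iff₀ (by positivity)] at h3
    nlinarith
  · rw [hab, ← hb]
    have : a = (d : ℂ)⁻¹ - d * b := by
      field_simp
      linear_combination e1
    rw [this]

end Reduction

/-! ### Norm and trace identities for the partial trace. -/

section PartialTrace

open scoped Matrix.Norms.L2Operator

variable {α β : Type*} [Fintype β] [DecidableEq β]

/-- Partial trace over the second register followed by tensoring with the identity. -/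
def twirl (M : Matrix (α × β) (α × β) ℂ) : Matrix (α × β) (α × β) ℂ :=
  Matrix.of fun a b => if a.2 = b.2 then ∑ k, M (a.1, k) (b.1, k) else 0

theorem twirl_twirl (M : Matrix (α × β) (α × β) ℂ) :
    twirl (twirl M) = (Fintype.card β : ℂ) • twirl M := by
  ext a b
  by_cases h : a.2 = b.2 <;> simp [twirl, h]

variable [Fintype α]

theorem trace_twirl_mul (M N : Matrix (α × β) (α × β) ℂ) :
    (twirl M * N).trace = (M * twirl N).trace := by
  simp only [Matrix.trace, Matrix.diag_apply, Matrix.mul_apply, twirl, Matrix.of_apply,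
    Fintype.sum_prod_type, ite_mul, mul_ite, zero_mul, mul_zero, Finset.sum_ite_eq, Finset.sum_ite_eq',
    Finset.mem_univ, if_true]
  refine Finset.sum_congr rfl fun x _ => ?_
  rw [Finset.sum_comm]
  conv_rhs => rw [Finset.sum_comm]
  refine Finset.sum_congr rfl fun y _ => ?_
  rw [← Finset.mul_sum, ← Finset.sum_mul]

variable [DecidableEq α]

theorem norm_one_le : ‖(1 : Matrix α α ℂ)‖ ≤ 1 :=
  norm_le_one_of_mem_unitaryGroup (one_mem _)

/-- Tensoring with the identity is a star homomorphism of C⋆-algebras, hence contractive. -/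
theorem norm_kronecker_one_le (A : Matrix α α ℂ) :
    ‖Matrix.kronecker A (1 : Matrix β β ℂ)‖ ≤ ‖A‖ := by
  let f : Matrix α α ℂ →⋆ₙₐ[ℂ] Matrix (α × β) (α × β) ℂ :=
    { toFun := fun A => Matrix.kronecker A 1
      map_smul' := fun c A => Matrix.smul_kronecker c A 1
      map_zero' := Matrix.zero_kronecker 1
      map_add' := fun A B => Matrix.add_kronecker A B 1
      map_mul' := fun A B => by
        have := Matrix.mul_kronecker_mul A B (1 : Matrix β β ℂ) (1 : Matrix β β ℂ)
        rwa [Matrix.one_mul] at this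
      map_star' := fun A => by
        have := Matrix.conjTranspose_kronecker A (1 : Matrix β β ℂ)
        rw [Matrix.conjTranspose_one] at this
        exact this.symm }
  exact NonUnitalStarAlgHom.norm_apply_le f A

theorem norm_twirl_le (M : Matrix (α × β) (α × β) ℂ) : ‖twirl M‖ ≤ Fintype.card β * ‖M‖ := by
  -- The isometries x ↦ x ⊗ k write the partial trace as a sum of one compression of M for each k,
  -- whence the factor `Fintype.card β`.
  let F : β → Matrix (α × β) α ℂ := fun k => Matrix.of fun a x => if a = (x, k) then 1 else 0
  have hF : ∀ k, ‖F k‖ ≤ 1 := by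
    intro k
    have h1 : (F k)ᴴ * F k = 1 := by
      ext x y
      simp [F, Matrix.mul_apply, Matrix.one_apply, apply_ite star, eq_comm]
    have h2 := Matrix.l2_opNorm_conjTranspose_mul_self (F k)
    rw [h1] at h2
    have h3 := norm_one_le (α := α)
    nlinarith [norm_nonneg (F k)]
  have hM : twirl M = Matrix.kronecker (∑ k, (F k)ᴴ * M * F k) (1 : Matrix β β ℂ) := by
    ext a b
    rw [Matrix.kronecker, Matrix.kroneckerMap_apply, Matrix.sum_apply]
    by_cases h : a.2 = b.2 <;>
      simp [twirl, h, F, Matrix.mul_apply, Matrix.one_apply, apply_ite star]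
  rw [hM]
  refine (norm_kronecker_one_le _).trans ((norm_sum_le _ _).trans ?_)
  have : ∀ k, ‖(F k)ᴴ * M * F k‖ ≤ ‖M‖ := by
    intro k
    calc ‖(F k)ᴴ * M * F k‖ ≤ ‖(F k)ᴴ‖ * ‖M‖ * ‖F k‖ :=
          (Matrix.l2_opNorm_mul _ _).trans
            (mul_le_mul_of_nonneg_right (Matrix.l2_opNorm_mul _ _) (norm_nonneg _))
      _ ≤ 1 * ‖M‖ * 1 := by
          rw [Matrix.l2_opNorm_conjTranspose]
          gcongr <;> exact hF k
      _ = ‖M‖ := by ring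
  refine (Finset.sum_le_sum fun k _ => this k).trans ?_
  simp

end PartialTrace

/-! ### Trace norm of a two-sided compression. -/

section Compression

open scoped ComplexOrder

variable {ι : Type*} [Fintype ι]

theorem two_mul_re_trace_conjTranspose_mul_le (X Z : Matrix ι ι ℂ) :
    2 * (Xᴴ * Z).trace.re ≤ (Xᴴ * X).trace.re + (Zᴴ * Z).trace.re := by
  have h := (Matrix.posSemidef_conjTranspose_mul_self (X - Z)).trace_nonneg
  have h2 : (Zᴴ * X).trace.re = (Xᴴ * Z).trace.re := by
    have : Zᴴ * X = (Xᴴ * Z)ᴴ := by simp [Matrix.conjTranspose_mul]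
    rw [this, Matrix.trace_conjTranspose]
    exact Complex.conj_re _
  have h3 := (Complex.le_def.mp h).1
  simp only [Matrix.conjTranspose_sub, Matrix.sub_mul, Matrix.mul_sub, Matrix.trace_sub,
    Complex.sub_re, Complex.zero_re] at h3
  linarith

variable [DecidableEq ι]

/-- The trace norm of a compression `B A B` is bounded by a linear functional of `B²`. -/
theorem exists_traceNorm_compression_le (A : Matrix ι ι ℂ) :
    ∃ H : Matrix ι ι ℂ, H.trace = 2 * traceNorm A ∧ ∀ B : Matrix ι ι ℂ, B.IsHermitian →
      2 * traceNorm (B * A * B) ≤ (B * B * H).trace.re := by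
  obtain ⟨U, hU, V, hV, σ, hσ, hA, hs⟩ := exists_svd A
  -- Splitting the singular values evenly gives A = (U D)(V D)ᴴ, and H is the sum of the two Gram
  -- matrices, that is |Aᴴ| + |A|.
  let D : Matrix ι ι ℂ := Matrix.diagonal fun i => ((√(σ i) : ℝ) : ℂ)
  have hD : Dᴴ = D := by
    simp only [D, Matrix.diagonal_conjTranspose]
    congr 1
    ext i
    exact Complex.conj_ofReal _
  have hDD : D * D = Matrix.diagonal fun i => (σ i : ℂ) := by
    simp only [D, Matrix.diagonal_mul_diagonal, ← Complex.ofReal_mul, Real.mul_self_sqrt (hσ _)]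
  have htr : ∀ {W : Matrix ι ι ℂ}, W ∈ Matrix.unitaryGroup ι ℂ →
      ((W * D) * (W * D)ᴴ).trace = traceNorm A := by
    intro W hW
    have hW' : Wᴴ * W = 1 := Matrix.mem_unitaryGroup_iff'.mp hW
    rw [Matrix.trace_mul_comm, Matrix.conjTranspose_mul, hD]
    have : D * Wᴴ * (W * D) = D * (Wᴴ * W) * D := by simp only [Matrix.mul_assoc]
    rw [this, hW', Matrix.mul_one, hDD, Matrix.trace_diagonal, ← hs]
    push_cast
    rfl
  refine ⟨(U * D) * (U * D)ᴴ + (V * D) * (V * D)ᴴ, ?_, fun B hB => ?_⟩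
  · rw [Matrix.trace_add, htr hU, htr hV]; ring
  obtain ⟨W, hW, hWt⟩ := exists_trace_mul_eq_traceNorm (B * A * B)
  have hWW : Wᴴ * W = 1 := Matrix.mem_unitaryGroup_iff'.mp hW
  have hAK : A = (U * D) * (V * D)ᴴ := by
    rw [hA, ← hDD, Matrix.conjTranspose_mul, hD]
    simp only [Matrix.mul_assoc]
  generalize U * D = K at hAK ⊢
  generalize V * D = K' at hAK ⊢
  -- The cross term is the trace norm of B A B by the choice of W, and W drops out of the second
  -- square by unitarity.
  have key := two_mul_re_trace_conjTranspose_mul_le (B * K') (W * (B * K))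
  have e1 : ((B * K')ᴴ * (W * (B * K))).trace = traceNorm (B * A * B) := by
    rw [← hWt, Matrix.trace_mul_comm, hAK, Matrix.conjTranspose_mul, hB.eq]
    simp only [Matrix.mul_assoc]
  have e2 : ((B * K')ᴴ * (B * K')).trace = (B * B * (K' * K'ᴴ)).trace := by
    rw [Matrix.conjTranspose_mul, hB.eq, Matrix.mul_assoc, Matrix.trace_mul_comm]
    simp only [Matrix.mul_assoc]
  have e3 : ((W * (B * K))ᴴ * (W * (B * K))).trace = (B * B * (K * Kᴴ)).trace := by
    have : (W * (B * K))ᴴ * (W * (B * K)) = Kᴴ * (B * B * K) := by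
      rw [Matrix.conjTranspose_mul, Matrix.conjTranspose_mul, hB.eq]
      calc _ = Kᴴ * B * (Wᴴ * W) * B * K := by simp only [Matrix.mul_assoc]
        _ = _ := by rw [hWW]; simp only [Matrix.mul_assoc, Matrix.one_mul]
    rw [this, Matrix.trace_mul_comm]
    simp only [Matrix.mul_assoc]
  rw [e1, e2, e3, Complex.ofReal_re] at key
  rw [Matrix.mul_add, Matrix.trace_add, Complex.add_re]
  linarith

end Compression

/-! ### The ρ norm as a compression of the unnormalized Choi operator. -/

section RhoNorm

variable {d n : ℕ}

theorem tensorId_Psi_apply (L : Superoperator d n) (a b : Fin n × Fin d) :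
    tensorId L d (Psi d) a b = L (Matrix.single a.2 b.2 1) a.1 b.1 := by
  change L (Matrix.of fun p q => Psi d (p, a.2) (q, b.2)) a.1 b.1 = _
  refine congrArg (fun X => L X a.1 b.1) ?_
  ext p q
  by_cases h1 : p = a.2 <;> by_cases h2 : q = b.2 <;>
    simp [Psi, ketPsi, Matrix.vecMulVec_apply, h1, h2, eq_comm]

theorem kronecker_Psi_kronecker_apply (s : Matrix (Fin d) (Fin d) ℂ) (p i q j : Fin d) :
    (Matrix.kronecker s (1 : Matrix (Fin d) (Fin d) ℂ) * Psi d *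
      Matrix.kronecker s (1 : Matrix (Fin d) (Fin d) ℂ)) (p, i) (q, j) = s p i * s j q := by
  simp [Matrix.mul_apply, Fintype.sum_prod_type, Psi, ketPsi, Matrix.vecMulVec_apply,
    Matrix.kronecker, Matrix.kroneckerMap_apply, Matrix.one_apply, apply_ite star]

theorem tensorId_kronecker_Psi_apply (L : Superoperator d n) (s : Matrix (Fin d) (Fin d) ℂ)
    (a b : Fin n × Fin d) :
    tensorId L d (Matrix.kronecker s (1 : Matrix (Fin d) (Fin d) ℂ) * Psi d *
      Matrix.kronecker s (1 : Matrix (Fin d) (Fin d) ℂ)) a b =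
      ∑ k, ∑ l, s k a.2 * s b.2 l * tensorId L d (Psi d) (a.1, k) (b.1, l) := by
  have h : (Matrix.of fun p q => (Matrix.kronecker s (1 : Matrix (Fin d) (Fin d) ℂ) * Psi d *
      Matrix.kronecker s (1 : Matrix (Fin d) (Fin d) ℂ)) (p, a.2) (q, b.2))
      = ∑ k, ∑ l, (s k a.2 * s b.2 l) • Matrix.single k l (1 : ℂ) := by
    ext p q
    simp only [Matrix.of_apply, kronecker_Psi_kronecker_apply, Matrix.sum_apply, Matrix.smul_apply,
      Matrix.single_apply, smul_eq_mul, mul_ite, mul_one, mul_zero]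
    simp [ite_and]
  change L (Matrix.of fun p q => _) a.1 b.1 = _
  rw [h]
  simp only [map_sum, map_smul, Matrix.sum_apply, Matrix.smul_apply, smul_eq_mul,
    tensorId_Psi_apply]

/-- The transpose trick moves s to the second register, where it commutes with the action of L on
the first. -/
theorem tensorId_kronecker_Psi (L : Superoperator d n) (s : Matrix (Fin d) (Fin d) ℂ) :
    tensorId L d (Matrix.kronecker s (1 : Matrix (Fin d) (Fin d) ℂ) * Psi d *
      Matrix.kronecker s (1 : Matrix (Fin d) (Fin d) ℂ)) =
      Matrix.kronecker (1 : Matrix (Fin n) (Fin n) ℂ) sᵀ * tensorId L d (Psi d) *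
        Matrix.kronecker (1 : Matrix (Fin n) (Fin n) ℂ) sᵀ := by
  ext a b
  rw [tensorId_kronecker_Psi_apply, Finset.sum_comm]
  simp only [Matrix.mul_apply, Fintype.sum_prod_type, Matrix.kronecker, Matrix.kroneckerMap_apply,
    Matrix.one_apply, Matrix.transpose_apply, ite_mul, mul_ite, one_mul, zero_mul, mul_zero,
    Finset.sum_ite_irrel, Finset.sum_const_zero, Finset.sum_ite_eq, Finset.sum_ite_eq',
    Finset.mem_univ, if_true, Finset.sum_mul]
  refine Finset.sum_congr rfl fun l _ => Finset.sum_congr rfl fun k _ => ?_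
  ring

theorem acidNorm_eq (L : Superoperator d n) :
    acidNorm L = (d : ℝ)⁻¹ * traceNorm (tensorId L d (Psi d)) := by
  rw [acidNorm, choi, Phi, map_smul, ← traceNorm_smul _ (by positivity)]
  push_cast
  rfl

theorem rhoNorm_eq (ρ : Matrix (Fin d) (Fin d) ℂ) (L : Superoperator d n) :
    rhoNorm ρ L = traceNorm (Matrix.kronecker (1 : Matrix (Fin n) (Fin n) ℂ) (CFC.sqrt ρ)ᵀ *
      tensorId L d (Psi d) * Matrix.kronecker (1 : Matrix (Fin n) (Fin n) ℂ) (CFC.sqrt ρ)ᵀ) := by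
  rw [rhoNorm, tensorId_kronecker_Psi]

end RhoNorm

theorem integral_trace_mul {Ω ι : Type*} [MeasurableSpace Ω] {P : Measure Ω} [Fintype ι]
    {Y : Ω → Matrix ι ι ℂ}
    (hY : ∀ a b, Integrable (fun ω => Y ω a b) P) (V : Matrix ι ι ℂ) :
    ∫ ω, (V * Y ω).trace ∂P = (V * Matrix.of fun a b => ∫ ω, Y ω a b ∂P).trace := by
  simp only [Matrix.trace, Matrix.diag_apply, Matrix.mul_apply, Matrix.of_apply]
  have hVY : ∀ a b, Integrable (fun ω => V a b * Y ω b a) P := fun a b => (hY b a).const_mul _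
  rw [integral_finsetSum (f := fun a ω => ∑ b, V a b * Y ω b a) _ fun a _ =>
    integrable_finsetSum _ fun b _ => hVY a b]
  refine Finset.sum_congr rfl fun a _ => ?_
  rw [integral_finsetSum _ fun b _ => hVY a b]
  simp only [integral_const_mul]

/-! ### The two bounds on the expected ρ norm. -/

section HaarBounds

variable {d m n : ℕ} {Ω : Type*} [MeasurableSpace Ω] {P : Measure Ω} [IsProbabilityMeasure P]
  {ψ : Ω → EuclideanSpace ℂ (Fin d × Fin m)}

/-- The operator `1 ⊗ (√ρ)ᵀ`, where `ρ` is the reduction of `ψ`. -/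
noncomputable def sqrtFactor (n : ℕ) (ψ : EuclideanSpace ℂ (Fin d × Fin m)) :
    Matrix (Fin n × Fin d) (Fin n × Fin d) ℂ :=
  Matrix.kronecker (1 : Matrix (Fin n) (Fin n) ℂ) (CFC.sqrt (reduction ψ))ᵀ

theorem continuous_sqrtFactor :
    Continuous (sqrtFactor n : EuclideanSpace ℂ (Fin d × Fin m) → _) := by
  refine continuous_matrix fun a b => ?_
  simp only [sqrtFactor, Matrix.kronecker, Matrix.kroneckerMap_apply, Matrix.transpose_apply]
  exact continuous_const.mul (continuous_sqrt_reduction.matrix_elem _ _)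

theorem isHermitian_sqrtFactor (ψ : EuclideanSpace ℂ (Fin d × Fin m)) :
    (sqrtFactor n ψ).IsHermitian := by
  have h : (CFC.sqrt (reduction ψ)).IsHermitian := (CFC.sqrt_nonneg _).isSelfAdjoint
  rw [Matrix.IsHermitian, sqrtFactor, Matrix.kronecker, Matrix.conjTranspose_kronecker,
    Matrix.conjTranspose_one, h.transpose.eq]

theorem rhoNorm_reduction (ψ : EuclideanSpace ℂ (Fin d × Fin m)) (L : Superoperator d n) :
    rhoNorm (reduction ψ) L =
      traceNorm (sqrtFactor n ψ * tensorId L d (Psi d) * sqrtFactor n ψ) :=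
  rhoNorm_eq _ _

theorem continuous_compression (J : Matrix (Fin n × Fin d) (Fin n × Fin d) ℂ) :
    Continuous fun φ : EuclideanSpace ℂ (Fin d × Fin m) => sqrtFactor n φ * J * sqrtFactor n φ :=
  (continuous_sqrtFactor.matrix_mul continuous_const).matrix_mul continuous_sqrtFactor

theorem IsHaarRandomState.integrable_rhoNorm (hψ : IsHaarRandomState P ψ) (L : Superoperator d n) :
    Integrable (fun ω => rhoNorm (reduction (ψ ω)) L) P := by
  simp only [rhoNorm_reduction]
  exact hψ.integrable_comp (continuous_traceNorm.comp (continuous_compression _))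

theorem IsHaarRandomState.integral_sqrtFactor_sq (hd : 1 < d) (hψ : IsHaarRandomState P ψ) :
    (Matrix.of fun a b => ∫ ω, (sqrtFactor n (ψ ω) * sqrtFactor n (ψ ω)) a b ∂P)
      = (d : ℂ)⁻¹ • 1 := by
  obtain ⟨q, -, -, hq⟩ := hψ.integral_sqrt_mul_sqrt hd
  have hint := hψ.integrable_sqrt_mul_sqrt
  ext a b
  have h1 : ∀ ω, (sqrtFactor n (ψ ω) * sqrtFactor n (ψ ω)) a b = (1 : Matrix (Fin n) (Fin n) ℂ) a.1 b.1 *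
      ∑ k, CFC.sqrt (reduction (ψ ω)) b.2 k * CFC.sqrt (reduction (ψ ω)) k a.2 := by
    intro ω
    rw [sqrtFactor, Matrix.kronecker, ← Matrix.mul_kronecker_mul, ← Matrix.transpose_mul,
      Matrix.one_mul, Matrix.kroneckerMap_apply, Matrix.transpose_apply, Matrix.mul_apply]
  simp only [Matrix.of_apply, h1]
  rw [integral_const_mul, integral_finsetSum _ fun k _ => hint _ _ _ _]
  simp only [hq]
  have hd0 : (d : ℂ) ≠ 0 := by exact_mod_cast (by omega : d ≠ 0)
  -- Contracting the middle indices gives (1/d − dq) + dq, so the unknown q cancels.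
  by_cases h : a.1 = b.1 <;> by_cases h' : a.2 = b.2 <;>
    simp [Finset.sum_add_distrib, Matrix.one_apply, Prod.ext_iff, h, h', eq_comm]

theorem IsHaarRandomState.integral_rhoNorm_le (hd : 1 < d) (hψ : IsHaarRandomState P ψ)
    (L : Superoperator d n) :
    ∫ ω, rhoNorm (reduction (ψ ω)) L ∂P ≤ acidNorm L := by
  obtain ⟨H, hH, hle⟩ := exists_traceNorm_compression_le (tensorId L d (Psi d))
  have hcont : Continuous fun φ : EuclideanSpace ℂ (Fin d × Fin m) =>
      sqrtFactor n φ * sqrtFactor n φ :=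
    continuous_sqrtFactor.matrix_mul continuous_sqrtFactor
  have hint : Integrable (fun ω => (H * (sqrtFactor n (ψ ω) * sqrtFactor n (ψ ω))).trace) P :=
    hψ.integrable_comp (f := fun φ => (H * (sqrtFactor n φ * sqrtFactor n φ)).trace)
      (continuous_const.matrix_mul hcont).matrix_trace
  have h1 : ∫ ω, 2 * rhoNorm (reduction (ψ ω)) L ∂P ≤
      ∫ ω, ((H * (sqrtFactor n (ψ ω) * sqrtFactor n (ψ ω))).trace).re ∂P := by
    refine integral_mono ((hψ.integrable_rhoNorm L).const_mul 2) hint.re fun ω => ?_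
    beta_reduce
    rw [rhoNorm_reduction, Matrix.trace_mul_comm]
    exact hle _ (isHermitian_sqrtFactor _)
  have h2 : ∫ ω, ((H * (sqrtFactor n (ψ ω) * sqrtFactor n (ψ ω))).trace).re ∂P
      = (∫ ω, (H * (sqrtFactor n (ψ ω) * sqrtFactor n (ψ ω))).trace ∂P).re := integral_re hint
  rw [h2, integral_trace_mul fun a b => hψ.integrable_comp (hcont.matrix_elem a b),
    hψ.integral_sqrtFactor_sq hd, Matrix.mul_smul, Matrix.mul_one, Matrix.trace_smul, hH,
    integral_const_mul] at h1
  have h3 : ((d : ℂ)⁻¹ • (2 * (traceNorm (tensorId L d (Psi d)) : ℂ))).re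
      = 2 * acidNorm L := by
    have : (d : ℂ)⁻¹ • (2 * (traceNorm (tensorId L d (Psi d)) : ℂ))
        = ((2 * acidNorm L : ℝ) : ℂ) := by
      rw [acidNorm_eq, smul_eq_mul]
      push_cast
      ring
    rw [this, Complex.ofReal_re]
  linarith

/-- With t = d²q ≤ d/(d + m), the ratio (1 − t)/(1 + t) decreases in t and equals m/(2d + m) at the
endpoint. -/
theorem div_mul_le_of_one_sub_mul_le {d m q x y : ℝ} (hd : 0 < d) (hm : 0 ≤ m) (hq : 0 ≤ q)
    (hq1 : q * (d * (d + m)) ≤ 1) (hx : 0 ≤ x)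
    (h : (1 - d ^ 2 * q) * x ≤ (1 + d ^ 2 * q) * y) : m / (2 * d + m) * x ≤ y := by
  have hy0 : 0 < 1 + d ^ 2 * q := by positivity
  have h3 : m * (1 + d ^ 2 * q) ≤ (2 * d + m) * (1 - d ^ 2 * q) := by
    nlinarith [mul_le_mul_of_nonneg_left hq1 hd.le]
  rw [div_mul_eq_mul_div, div_le_iff₀ (by positivity)]
  refine le_of_mul_le_mul_left ?_ hy0
  calc (1 + d ^ 2 * q) * (m * x) = (m * (1 + d ^ 2 * q)) * x := by ring
    _ ≤ ((2 * d + m) * (1 - d ^ 2 * q)) * x := by gcongr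
    _ = (2 * d + m) * ((1 - d ^ 2 * q) * x) := by ring
    _ ≤ (2 * d + m) * ((1 + d ^ 2 * q) * y) := by gcongr
    _ = (1 + d ^ 2 * q) * (y * (2 * d + m)) := by ring

open scoped Matrix.Norms.L2Operator in
theorem IsHaarRandomState.le_integral_rhoNorm (hd : 1 < d) (hψ : IsHaarRandomState P ψ)
    (L : Superoperator d n) :
    (m : ℝ) / (2 * d + m) * acidNorm L ≤ ∫ ω, rhoNorm (reduction (ψ ω)) L ∂P := by
  obtain ⟨q, hq0, hq1, hq⟩ := hψ.integral_sqrt_mul_sqrt hd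
  have hint := hψ.integrable_sqrt_mul_sqrt
  have hd0 : (d : ℂ) ≠ 0 := by exact_mod_cast (by omega : d ≠ 0)
  have hdR : (0 : ℝ) < d := by exact_mod_cast (by omega : 0 < d)
  rw [acidNorm_eq]
  simp only [rhoNorm_reduction]
  have hrhoint := hψ.integrable_rhoNorm L
  simp only [rhoNorm_reduction] at hrhoint
  set J := tensorId L d (Psi d) with hJ
  have hYint : ∀ a b, Integrable (fun ω => (sqrtFactor n (ψ ω) * J * sqrtFactor n (ψ ω)) a b) P :=
    fun a b => hψ.integrable_comp ((continuous_compression J).matrix_elem a b)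
  have hEY : (Matrix.of fun a b => ∫ ω, (sqrtFactor n (ψ ω) * J * sqrtFactor n (ψ ω)) a b ∂P)
      = ((d : ℂ)⁻¹ - d * q) • J + (q : ℂ) • twirl J := by
    ext a b
    have h1 : ∀ ω, (sqrtFactor n (ψ ω) * J * sqrtFactor n (ψ ω)) a b = ∑ k, ∑ l,
        CFC.sqrt (reduction (ψ ω)) k a.2 * CFC.sqrt (reduction (ψ ω)) b.2 l
          * J (a.1, k) (b.1, l) := by
      intro ω
      rw [hJ, ← tensorId_kronecker_Psi_apply, tensorId_kronecker_Psi]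
      rfl
    simp only [Matrix.of_apply, h1]
    rw [integral_finsetSum _ fun k _ => integrable_finsetSum _ fun l _ => (hint _ _ _ _).mul_const _]
    simp_rw [integral_finsetSum _ fun l _ => (hint _ _ _ l).mul_const _, integral_mul_const, hq]
    by_cases h' : a.2 = b.2
    · have hJa : J (a.1, b.2) b = J a b := by rw [← h']
      simp [add_mul, Finset.sum_add_distrib, twirl, h', hJa, Finset.mul_sum]
    · simp [twirl, h']
  obtain ⟨W, hW, hWt⟩ := exists_trace_mul_eq_traceNorm J
  have hW1 := norm_le_one_of_mem_unitaryGroup hW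
  -- The coefficient qd is chosen so that, `twirl` being self-adjoint for the trace pairing with
  -- square d times itself, all multiples of tr(W · `twirl J`) cancel in `hVE`.
  let V := W - ((q * d : ℝ) : ℂ) • twirl W
  have hV : ‖V‖ ≤ 1 + d ^ 2 * q := by
    have h1 := norm_twirl_le W
    rw [Fintype.card_fin] at h1
    have h2 : ‖((q * d : ℝ) : ℂ) • twirl W‖ ≤ d ^ 2 * q := by
      rw [norm_smul, Complex.norm_of_nonneg (by positivity)]
      calc q * d * ‖twirl W‖ ≤ q * d * (d * 1) := by
            gcongr
            exact h1.trans (by gcongr)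
        _ = d ^ 2 * q := by ring
    exact (norm_sub_le _ _).trans (add_le_add hW1 h2)
  have hVE : (V * (((d : ℂ)⁻¹ - d * q) • J + (q : ℂ) • twirl J)).trace
      = (((d : ℝ)⁻¹ - d * q) * traceNorm J : ℝ) := by
    simp only [V, Matrix.sub_mul, Matrix.mul_add, Matrix.mul_smul, Matrix.smul_mul,
      Matrix.trace_sub, Matrix.trace_add, Matrix.trace_smul, trace_twirl_mul, twirl_twirl, hWt,
      smul_eq_mul, Fintype.card_fin]
    push_cast
    field_simp
    ring
  have htint : Integrable (fun ω => (V * (sqrtFactor n (ψ ω) * J * sqrtFactor n (ψ ω))).trace) P :=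
    hψ.integrable_comp (f := fun φ => (V * (sqrtFactor n φ * J * sqrtFactor n φ)).trace)
      (continuous_const.matrix_mul (continuous_compression J)).matrix_trace
  have key : ((d : ℝ)⁻¹ - d * q) * traceNorm J ≤ (1 + d ^ 2 * q) *
      ∫ ω, traceNorm (sqrtFactor n (ψ ω) * J * sqrtFactor n (ψ ω)) ∂P := by
    have h1 := integral_trace_mul hYint V
    rw [hEY, hVE] at h1
    have h2 := congrArg Complex.re h1
    rw [Complex.ofReal_re] at h2
    rw [← h2, ← integral_const_mul]
    have h3 : (∫ ω, (V * (sqrtFactor n (ψ ω) * J * sqrtFactor n (ψ ω))).trace ∂P).re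
        = ∫ ω, (V * (sqrtFactor n (ψ ω) * J * sqrtFactor n (ψ ω))).trace.re ∂P :=
      (integral_re htint).symm
    rw [h3]
    refine integral_mono htint.re (hrhoint.const_mul _) fun ω => ?_
    refine (Complex.re_le_norm _).trans ((norm_trace_mul_le _ _).trans ?_)
    exact mul_le_mul_of_nonneg_right hV (traceNorm_nonneg _)
  set E := ∫ ω, traceNorm (sqrtFactor n (ψ ω) * J * sqrtFactor n (ψ ω)) ∂P
  have h2 : (1 - d ^ 2 * q) * ((d : ℝ)⁻¹ * traceNorm J) ≤ (1 + d ^ 2 * q) * E := by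
    refine le_trans (le_of_eq ?_) key
    field_simp
  exact div_mul_le_of_one_sub_mul_le hdR (Nat.cast_nonneg m) hq0 hq1
    (mul_nonneg (inv_nonneg.mpr hdR.le) (traceNorm_nonneg J)) h2

end HaarBounds

end AcidNorm

theorem corollary5p7 {d m n : ℕ} (hd : 1 < d)
    {Ω : Type*} [MeasurableSpace Ω] (P : Measure Ω) [IsProbabilityMeasure P]
    (ψ : Ω → EuclideanSpace ℂ (Fin d × Fin m)) (hψ : AcidNorm.IsHaarRandomState P ψ)
    (L : AcidNorm.Superoperator d n) :
    Integrable (fun ω => AcidNorm.rhoNorm (AcidNorm.reduction (ψ ω)) L) P ∧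
    (m : ℝ) / (2 * (d : ℝ) + (m : ℝ)) * AcidNorm.acidNorm L
      ≤ ∫ ω, AcidNorm.rhoNorm (AcidNorm.reduction (ψ ω)) L ∂P ∧
    ∫ ω, AcidNorm.rhoNorm (AcidNorm.reduction (ψ ω)) L ∂P ≤ AcidNorm.acidNorm L := by
  exact ⟨hψ.integrable_rhoNorm L, hψ.le_integral_rhoNorm hd L, hψ.integral_rhoNorm_le hd L⟩
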